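/- **Theorem (Sparse linear regression, transfer lasso).** Fix integers $K\ge 0$, $s\ge 0$ and constants $M,\kappa>0$, $\sigma^2\ge 0$. *Model.* For $k=0,1,\dots,K$ ($k=0$ is the target, $k\ge 1$ are the sources) and $1\le i\le n_k$ let $y_{k,i}=\langle\theta_k^*,X_{k,i}\rangle+\varepsilon_{k,i}$ with $\theta^*_k\in\mathbb R^p$, where all the $X_{k,i}\sim N(0,\Sigma_k)$ are independent, the noise variables $\varepsilon_{k,i}$ are i.i.d. (over all $k,i$) and independent of the designs, and their common law is centred sub-Gaussian with variance proxy $\sigma^2$, i.e. $\mathbb E e^{u\varepsilon}\le e^{\sigma^2u^2/2}$ for all $u\in\mathbb R$. The matrices $\Sigma_k$ are positive definite with $\max_{j\le p}(\Sigma_k)_{jj}\le M$ and smallest eigenvalue at least $\kappa$. The vector $\theta^*_0$ has at most $s$ nonzero coordinates, and $\|\theta_0^*-\theta_k^*\|_1\le h$ for all $k$, where $h\ge 0$. Put $n_P=\sum_{k=0}^K n_k$. *Estimator.* Pooling step: for $\lambda_P>0$ let $$\hat\theta_P\in\arg\min_{\theta}\ \frac1{n_P}\sum_{k=0}^K\sum_{i\le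 n_k}\tfrac12\big(y_{k,i}-\langle\theta,X_{k,i}\rangle\big)^2+\lambda_P\|\theta\|_1 .$$ Fine-tuning step, with $L_0(\theta)=\frac1{n_0}\sum_{i\le n_0}\frac12(y_{0,i}-\langle\theta,X_{0,i}\rangle)^2$: either the constrained form $\hat\theta^\star\in\arg\min\{L_0(\theta):\|\hat\theta_P-\theta\|_1\le r_d\}$, or the Lagrangian form $\hat\theta^\star=\hat\theta_P+\hat\delta$ with $\hat\delta\in\arg\min_\delta\{L_0(\hat\theta_P+\delta)+\zeta_d\|\delta\|_1\}$. *Claim.* Consider the asymptotic regime $\min_{0\le k\le K}n_k\to\infty$, $p\to\infty$, $\log p/n_P\to0$, $h\to0$ and $\log p=O(n_0)$, with $K,s,M,\kappa,\sigma^2$ fixed. There is a constant $C_0>0$ depending only on $(K,s,M,\kappa,\sigma^2)$ such that, for every constant $C_1$, if eventually $$C_0\Big(\sqrt{\tfrac{\log p}{n_P}}+h\Big)\le\lambda_P\le C_1\Big(\sqrt{\tfrac{\log p}{n_P}}+h\Big),$$ then there are deterministic tuning parameters $r_d>0$ and $\zeta_d>0$ (chosen independently of the particular models within the class above) such that, for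 any choice of the models and of the minimizers, both the constrained estimator with radius $r_d$ and the Lagrangian estimator with penalty $\zeta_d$ satisfy $$\|\hat\theta^\star-\theta_0^*\|_2^2=O_p\left(\min\left\{\sqrt{\frac{\log p}{n_0}}\Big(\sqrt{\frac{\log p}{n_P}}+h\Big),\ \frac{\log p}{n_P}+h^2\right\}\right).$$ -/

import Mathlib

open MeasureTheory ProbabilityTheory Filter Topology
open scoped NNReal ENNReal

noncomputable section

namespace TransferLasso

/-- The `ℓ¹` norm on `ℝᵖ`. -/
def l1Norm {p : ℕ} (v : EuclideanSpace ℝ (Fin p)) : ℝ := ∑ j, |v j|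

/-- `v` has at most `s` nonzero coordinates. -/
def IsSparse {p : ℕ} (s : ℕ) (v : EuclideanSpace ℝ (Fin p)) : Prop :=
  {j : Fin p | v j ≠ 0}.ncard ≤ s

/-- The pooled sample size `n₀ + n₁ + ⋯ + n_K`; the index `0` is the target. -/
def pooledSize {K : ℕ} (n : Fin (K + 1) → ℕ) : ℕ := ∑ k, n k

/-- Responses of the linear models: `y k i = ⟨θ k, x k i⟩ + e k i`. -/
def response {K p : ℕ} {n : Fin (K + 1) → ℕ} (θ : Fin (K + 1) → EuclideanSpace ℝ (Fin p))
    (x : ∀ k, Fin (n k) → EuclideanSpace ℝ (Fin p)) (e : ∀ k, Fin (n k) → ℝ) :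
    ∀ k, Fin (n k) → ℝ :=
  fun k i => inner ℝ (θ k) (x k i) + e k i

/-- Least squares loss of the pooled data (all weights equal to one). -/
def pooledLoss {K p : ℕ} {n : Fin (K + 1) → ℕ}
    (x : ∀ k, Fin (n k) → EuclideanSpace ℝ (Fin p)) (y : ∀ k, Fin (n k) → ℝ)
    (b : EuclideanSpace ℝ (Fin p)) : ℝ :=
  (1 / (pooledSize n : ℝ)) * ∑ k, ∑ i, (1 / 2 : ℝ) * (y k i - inner ℝ b (x k i)) ^ 2

/-- Least squares loss of the target data. -/
def targetLoss {K p : ℕ} {n : Fin (K + 1) → ℕ}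
    (x : ∀ k, Fin (n k) → EuclideanSpace ℝ (Fin p)) (y : ∀ k, Fin (n k) → ℝ)
    (b : EuclideanSpace ℝ (Fin p)) : ℝ :=
  (1 / (n 0 : ℝ)) * ∑ i, (1 / 2 : ℝ) * (y 0 i - inner ℝ b (x 0 i)) ^ 2

/-- `b` is a solution of the pooling step with penalty level `lam`. -/
def IsPooledEstimate {K p : ℕ} {n : Fin (K + 1) → ℕ}
    (x : ∀ k, Fin (n k) → EuclideanSpace ℝ (Fin p)) (y : ∀ k, Fin (n k) → ℝ)
    (lam : ℝ) (b : EuclideanSpace ℝ (Fin p)) : Prop :=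
  ∀ b' : EuclideanSpace ℝ (Fin p),
    pooledLoss x y b + lam * l1Norm b ≤ pooledLoss x y b' + lam * l1Norm b'

/-- `b` solves the constrained fine-tuning problem around `bP` with radius `r`. -/
def IsConstrainedEstimate {K p : ℕ} {n : Fin (K + 1) → ℕ}
    (x : ∀ k, Fin (n k) → EuclideanSpace ℝ (Fin p)) (y : ∀ k, Fin (n k) → ℝ)
    (r : ℝ) (bP b : EuclideanSpace ℝ (Fin p)) : Prop :=
  l1Norm (bP - b) ≤ r ∧
    ∀ b' : EuclideanSpace ℝ (Fin p), l1Norm (bP - b') ≤ r → targetLoss x y b ≤ targetLoss x y b'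

/-- `b = bP + d`, where `d` solves the Lagrangian fine-tuning problem around `bP` with
penalty level `ζ`. -/
def IsLagrangianEstimate {K p : ℕ} {n : Fin (K + 1) → ℕ}
    (x : ∀ k, Fin (n k) → EuclideanSpace ℝ (Fin p)) (y : ∀ k, Fin (n k) → ℝ)
    (ζ : ℝ) (bP b : EuclideanSpace ℝ (Fin p)) : Prop :=
  ∃ d : EuclideanSpace ℝ (Fin p), b = bP + d ∧
    ∀ d' : EuclideanSpace ℝ (Fin p),
      targetLoss x y (bP + d) + ζ * l1Norm d ≤ targetLoss x y (bP + d') + ζ * l1Norm d'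

/-- The linear transfer model with Gaussian designs: `θ k` are the parameters, `S k` the
covariance matrices of the designs, `ν` the common noise law, `X k i` the rows of the designs
and `ξ k i` the noise variables. -/
structure IsModel {K p : ℕ} {n : Fin (K + 1) → ℕ} {Ω : Type*} [MeasurableSpace Ω]
    (s : ℕ) (M κ : ℝ) (σ2 : ℝ≥0) (h : ℝ) (P : Measure Ω)
    (θ : Fin (K + 1) → EuclideanSpace ℝ (Fin p)) (S : Fin (K + 1) → Matrix (Fin p) (Fin p) ℝ)
    (ν : Measure ℝ) (X : ∀ k, Fin (n k) → Ω → EuclideanSpace ℝ (Fin p))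
    (ξ : ∀ k, Fin (n k) → Ω → ℝ) : Prop where
  prob : IsProbabilityMeasure P
  sparse : IsSparse s (θ 0)
  contrast : ∀ k, l1Norm (θ 0 - θ k) ≤ h
  posDef : ∀ k, (S k).PosDef
  eigenvalue_ge : ∀ k (v : Fin p → ℝ), κ * (v ⬝ᵥ v) ≤ v ⬝ᵥ (S k).mulVec v
  diag_le : ∀ k j, S k j j ≤ M
  subgaussian : HasSubgaussianMGF id σ2 ν
  design_law : ∀ k i, HasLaw (X k i) (multivariateGaussian 0 (S k)) P
  noise_law : ∀ k i, HasLaw (ξ k i) ν P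
  design_indep : iIndepFun (fun (q : Σ k, Fin (n k)) ω => X q.1 q.2 ω) P
  noise_indep : iIndepFun (fun (q : Σ k, Fin (n k)) ω => ξ q.1 q.2 ω) P
  design_noise_indep : IndepFun (fun ω (q : Σ k, Fin (n k)) => X q.1 q.2 ω)
    (fun ω (q : Σ k, Fin (n k)) => ξ q.1 q.2 ω) P

/-- `Z t = O_p(a t)` as `t → ∞`: for every `ε > 0` there is a constant `C` such that
`|Z t| ≤ C |a t|` outside an event of probability at most `ε`, for all large `t`. -/
def IsBigOp {Ω : ℕ → Type*} [∀ t, MeasurableSpace (Ω t)] (P : ∀ t, Measure (Ω t))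
    (Z : ∀ t, Ω t → ℝ) (a : ℕ → ℝ) : Prop :=
  ∀ ε : ℝ, 0 < ε → ∃ C : ℝ, 0 < C ∧
    ∀ᶠ t in atTop, P t {ω | C * |a t| < |Z t ω|} ≤ ENNReal.ofReal ε

/-- `√(log p / m) + h`. -/
def poolingRate (p m : ℕ) (h : ℝ) : ℝ := √(Real.log p / m) + h

/-- `min {√(log p / n₀) (√(log p / n_P) + h), log p / n_P + h²}`. -/
def transferRate (p n₀ nP : ℕ) (h : ℝ) : ℝ :=
  min (√(Real.log p / n₀) * (√(Real.log p / nP) + h)) (Real.log p / nP + h ^ 2)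

end TransferLasso

end

namespace TransferLasso

/-! ### Exponential moments of squared Gaussian variables -/

/-! All randomness is confined to one event per sample, pooled and target: every entry of the Gram
matrix and every design-noise correlation deviates by at most a constant times `√(log p / N)` per
observation. Exponential moments of squared Gaussians, a Chernoff bound and a union bound give this
event probability at least `1 - 4 / p` (`IsSample.measure_not_hasSmallDeviations_le`). The rest is
deterministic.

In the pooling step the lasso is compared directly with the sparse target parameter. Source
contrasts act as extra noise of size `h` in the gradient, so a penalty of order `w = √(log p / n_P)
+ h` dominates both noise and bias. Entrywise deviations change quadratic forms by at most a
multiple of `‖v‖₁²`, which the lasso cone absorbs; the pooled estimate thus has `ℓ¹` error `O(w)`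
(`l1Norm_lasso_sub_le`).

Fine-tuning uses only this `ℓ¹` radius `r ≍ w`. Optimality keeps the error `v` within `ℓ¹` norm
`4r`, and the basic inequality bounds `κ‖v‖₂²` by a multiple of `√(log p / n₀) (r + r²)`: the first
rate. The second is `‖v‖₂ ≤ ‖v‖₁ ≤ 4r`. -/

lemma lintegral_exp_mul_sq_gaussianReal (v : ℝ≥0) {a : ℝ} (ha : 2 * a * v < 1) :
    ∫⁻ x, ENNReal.ofReal (Real.exp (a * x ^ 2)) ∂(gaussianReal 0 v) =
      ENNReal.ofReal (√(1 - 2 * a * v))⁻¹ := by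
  rcases eq_or_ne v 0 with rfl | hv
  · simp
  have hv' : (0 : ℝ) < v := by positivity
  have hb : 0 < 1 / (2 * (v : ℝ)) - a := by
    rw [sub_pos, lt_div_iff₀ (by positivity)]; linarith
  have hpt : ∀ x : ℝ, gaussianPDFReal 0 v x * Real.exp (a * x ^ 2) =
      (√(2 * Real.pi * v))⁻¹ * Real.exp (-(1 / (2 * (v : ℝ)) - a) * x ^ 2) := by
    intro x
    rw [gaussianPDFReal, mul_assoc, ← Real.exp_add]
    congr 2
    field_simp
    ring
  rw [gaussianReal_of_var_ne_zero _ hv, lintegral_withDensity_eq_lintegral_mul _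
    (measurable_gaussianPDF 0 v) (by fun_prop)]
  simp only [Pi.mul_apply, gaussianPDF]
  simp_rw [← ENNReal.ofReal_mul (gaussianPDFReal_nonneg _ _ _), hpt]
  rw [← ofReal_integral_eq_lintegral_ofReal ((integrable_exp_neg_mul_sq hb).const_mul _)
    (Eventually.of_forall fun x => by positivity), integral_const_mul, integral_gaussian,
    ← Real.sqrt_inv, ← Real.sqrt_inv, ← Real.sqrt_mul (by positivity)]
  congr 2
  have : 1 - 2 * a * v ≠ 0 := by linarith
  have : 1 - a * (2 * v) ≠ 0 := by intro h; apply this; linarith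
  field_simp

/-- Taylor: `-log (1 - x)` differs from `x` by at most `x² / (1 - |x|) ≤ 2x²`. The linear term must
be exact, since centring has to cancel it later. -/
lemma inv_sqrt_one_sub_le {x : ℝ} (hx : |x| ≤ 1 / 2) :
    (√(1 - x))⁻¹ ≤ Real.exp (x / 2 + x ^ 2) := by
  have h1 : 0 < 1 - x := by have := (abs_le.1 hx).2; linarith
  have h2 := Real.abs_log_sub_add_sum_range_le (x := x) (by linarith) 1
  simp only [Finset.range_one, Finset.sum_singleton, zero_add, pow_one, Nat.cast_zero, div_one,
    one_add_one_eq_two, sq_abs] at h2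
  have h3 : x ^ 2 / (1 - |x|) ≤ 2 * x ^ 2 := by
    rw [div_le_iff₀ (by linarith)]; nlinarith [sq_nonneg x]
  have h4 := (abs_le.1 (h2.trans h3)).1
  rw [Real.sqrt_eq_rpow, ← Real.rpow_neg h1.le, Real.rpow_def_of_pos h1, Real.exp_le_exp]
  linarith

lemma lintegral_exp_mul_sq_gaussianReal_le (v : ℝ≥0) {a : ℝ} (ha : |a| * v ≤ 1 / 4) :
    ∫⁻ x, ENNReal.ofReal (Real.exp (a * x ^ 2)) ∂(gaussianReal 0 v) ≤
      ENNReal.ofReal (Real.exp (a * v + 4 * (a * v) ^ 2)) := by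
  have h : |2 * a * v| ≤ 1 / 2 := by
    rw [abs_mul, abs_mul, NNReal.abs_eq]; norm_num; linarith
  rw [lintegral_exp_mul_sq_gaussianReal v (by have := (abs_le.1 h).2; linarith)]
  refine ENNReal.ofReal_le_ofReal ((inv_sqrt_one_sub_le h).trans (le_of_eq ?_))
  ring_nf

/-! ### Linear images of Gaussian vectors -/

variable {p : ℕ}

/-- The quadratic form of the matrix `S` at `w`. -/
noncomputable def quadForm (S : Matrix (Fin p) (Fin p) ℝ) (w : EuclideanSpace ℝ (Fin p)) : ℝ :=
  w.ofLp ⬝ᵥ S.mulVec w.ofLp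

lemma map_inner_multivariateGaussian {S : Matrix (Fin p) (Fin p) ℝ} (hS : S.PosSemidef)
    (w : EuclideanSpace ℝ (Fin p)) :
    (multivariateGaussian 0 S).map (fun x => inner ℝ w x) =
      gaussianReal 0 (quadForm S w).toNNReal := by
  have h := IsGaussian.map_eq_gaussianReal (μ := multivariateGaussian 0 S) (innerSL ℝ w)
  have h0 : (multivariateGaussian 0 S)[innerSL ℝ w] = 0 := by
    rw [ContinuousLinearMap.integral_comp_id_comm IsGaussian.integrable_id,
      integral_id_multivariateGaussian, map_zero]
  have h1 : Var[innerSL ℝ w; multivariateGaussian 0 S] = quadForm S w := by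
    rw [quadForm, ← covarianceBilin_multivariateGaussian (μ := 0) hS,
      covarianceBilin_self IsGaussian.memLp_two_id]
    rfl
  rw [h0, h1] at h
  exact h

lemma quadForm_nonneg {S : Matrix (Fin p) (Fin p) ℝ} (hS : S.PosSemidef)
    (w : EuclideanSpace ℝ (Fin p)) : 0 ≤ quadForm S w := by
  simpa [quadForm] using hS.dotProduct_mulVec_nonneg w.ofLp

/-- The projection on `w` is a centred real Gaussian. Only the second-order term is relaxed to the
uniform bound `V`; the first-order term keeps the true variance. -/
lemma lintegral_exp_mul_inner_sq_le {S : Matrix (Fin p) (Fin p) ℝ} (hS : S.PosSemidef)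
    (w : EuclideanSpace ℝ (Fin p)) {V a : ℝ} (hV : quadForm S w ≤ V) (ha : |a| * V ≤ 1 / 4) :
    ∫⁻ x, ENNReal.ofReal (Real.exp (a * inner ℝ w x ^ 2)) ∂(multivariateGaussian 0 S) ≤
      ENNReal.ofReal (Real.exp (a * quadForm S w + 4 * (a * V) ^ 2)) := by
  have h0 := quadForm_nonneg hS w
  have hm : Measurable fun x : EuclideanSpace ℝ (Fin p) => (inner ℝ w x : ℝ) := by fun_prop
  have h1 : |a| * quadForm S w ≤ |a| * V := by gcongr
  have h := lintegral_exp_mul_sq_gaussianReal_le (quadForm S w).toNNReal (a := a)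
    (by rw [Real.coe_toNNReal _ h0]; linarith)
  rw [← map_inner_multivariateGaussian hS, lintegral_map (by fun_prop) hm,
    Real.coe_toNNReal _ h0] at h
  refine h.trans (ENNReal.ofReal_le_ofReal (Real.exp_le_exp.2 ?_))
  rw [mul_pow, mul_pow]
  gcongr

/-! ### Sums over independent samples -/

variable {ι : Type} [Fintype ι] {Ω : Type*} [MeasurableSpace Ω]

/-- The probabilistic assumptions on a finite sample of designs and noise variables. -/
structure IsSample (M : ℝ) (σ2 : ℝ≥0) (P : Measure Ω) (S : ι → Matrix (Fin p) (Fin p) ℝ)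
    (ν : Measure ℝ) (X : ι → Ω → EuclideanSpace ℝ (Fin p)) (ξ : ι → Ω → ℝ) : Prop where
  prob : IsProbabilityMeasure P
  posSemidef : ∀ q, (S q).PosSemidef
  diag_le : ∀ q j, S q j j ≤ M
  subgaussian : HasSubgaussianMGF id σ2 ν
  design_law : ∀ q, HasLaw (X q) (multivariateGaussian 0 (S q)) P
  noise_law : ∀ q, HasLaw (ξ q) ν P
  design_indep : iIndepFun X P
  noise_indep : iIndepFun ξ P
  design_noise_indep : IndepFun (fun ω q => X q ω) (fun ω q => ξ q ω) P

lemma lintegral_pi_prod {E : ι → Type*} [∀ q, MeasurableSpace (E q)] (μ : ∀ q, Measure (E q))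
    [∀ q, IsProbabilityMeasure (μ q)] {f : ∀ q, E q → ℝ≥0∞} (hf : ∀ q, Measurable (f q)) :
    ∫⁻ x, ∏ q, f q (x q) ∂(Measure.pi μ) = ∏ q, ∫⁻ y, f q y ∂(μ q) := by
  have h : iIndepFun (fun q (x : ∀ q, E q) => f q (x q)) (Measure.pi μ) :=
    iIndepFun_pi (X := f) fun q => (hf q).aemeasurable
  rw [lintegral_prod_eq_prod_lintegral_of_indepFun _ _ h
    fun q => (hf q).comp (measurable_pi_apply q)]
  refine Finset.prod_congr rfl fun q _ => ?_
  exact (measurePreserving_eval μ q).lintegral_comp (hf q)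

lemma ofReal_exp_sum (f : ι → ℝ) :
    ENNReal.ofReal (Real.exp (∑ q, f q)) = ∏ q, ENNReal.ofReal (Real.exp (f q)) := by
  rw [Real.exp_sum, ENNReal.ofReal_prod_of_nonneg fun _ _ => (Real.exp_pos _).le]

lemma prod_ofReal_exp_le {f : ι → ℝ≥0∞} {c : ℝ}
    (h : ∀ q, f q ≤ ENNReal.ofReal (Real.exp c)) :
    ∏ q, f q ≤ ENNReal.ofReal (Real.exp (Fintype.card ι * c)) := by
  refine (Finset.prod_le_prod' fun q _ => h q).trans (le_of_eq ?_)
  rw [← ofReal_exp_sum]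
  simp

variable {M : ℝ} {σ2 : ℝ≥0} {P : Measure Ω} {S : ι → Matrix (Fin p) (Fin p) ℝ}
  {ν : Measure ℝ} {X : ι → Ω → EuclideanSpace ℝ (Fin p)} {ξ : ι → Ω → ℝ}

/-- Deviation of the empirical second moment in direction `w`. -/
noncomputable def sqDeviation (S : ι → Matrix (Fin p) (Fin p) ℝ)
    (w : EuclideanSpace ℝ (Fin p)) (x : ι → EuclideanSpace ℝ (Fin p)) : ℝ :=
  ∑ q, (inner ℝ w (x q) ^ 2 - quadForm (S q) w)

/-- Independence factorizes the moment; in each factor the centring cancels the linear term and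
leaves `4(uV)²`. -/
lemma IsSample.lintegral_exp_sqDeviation_le (h : IsSample M σ2 P S ν X ξ)
    (w : EuclideanSpace ℝ (Fin p)) {V u : ℝ} (hV : ∀ q, quadForm (S q) w ≤ V)
    (hu : |u| * V ≤ 1 / 4) :
    ∫⁻ ω, ENNReal.ofReal (Real.exp (u * sqDeviation S w fun q => X q ω)) ∂P ≤
      ENNReal.ofReal (Real.exp (Fintype.card ι * (4 * (u * V) ^ 2))) := by
  have hl := h.design_indep.hasLaw_pi h.design_law
  have hm : Measurable fun x : EuclideanSpace ℝ (Fin p) => (inner ℝ w x : ℝ) := by fun_prop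
  have hm1 (q : ι) : Measurable fun x : EuclideanSpace ℝ (Fin p) =>
      ENNReal.ofReal (Real.exp (u * (inner ℝ w x ^ 2 - quadForm (S q) w))) := by fun_prop
  calc _ = ∫⁻ x, ∏ q, ENNReal.ofReal (Real.exp (u * (inner ℝ w (x q) ^ 2 - quadForm (S q) w)))
        ∂(Measure.pi fun q => multivariateGaussian 0 (S q)) := by
        rw [← hl.lintegral_comp (f := fun x => ∏ q, ENNReal.ofReal (Real.exp
          (u * (inner ℝ w (x q) ^ 2 - quadForm (S q) w)))) (Finset.measurable_prod _ fun q _ =>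
          (hm1 q).comp (measurable_pi_apply q)).aemeasurable]
        simp_rw [← ofReal_exp_sum, sqDeviation, Finset.mul_sum]
    _ ≤ _ := by
        rw [lintegral_pi_prod _ hm1]
        refine prod_ofReal_exp_le fun q => ?_
        have h1 := lintegral_exp_mul_inner_sq_le (h.posSemidef q) w (hV q) hu
        have h2 : ∀ x : EuclideanSpace ℝ (Fin p),
            ENNReal.ofReal (Real.exp (u * (inner ℝ w x ^ 2 - quadForm (S q) w))) =
            ENNReal.ofReal (Real.exp (-(u * quadForm (S q) w))) *
              ENNReal.ofReal (Real.exp (u * inner ℝ w x ^ 2)) := by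
          intro x
          rw [← ENNReal.ofReal_mul (Real.exp_pos _).le, ← Real.exp_add]
          ring_nf
        simp_rw [h2]
        rw [lintegral_const_mul _ (by fun_prop)]
        refine (mul_le_mul_right h1 _).trans (le_of_eq ?_)
        rw [← ENNReal.ofReal_mul (Real.exp_pos _).le, ← Real.exp_add]
        ring_nf

lemma lintegral_exp_mul_le_of_hasSubgaussianMGF (h : HasSubgaussianMGF id σ2 ν) (t : ℝ) :
    ∫⁻ x, ENNReal.ofReal (Real.exp (t * x)) ∂ν ≤ ENNReal.ofReal (Real.exp (σ2 * t ^ 2 / 2)) := by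
  have hi : Integrable (fun x => Real.exp (t * x)) ν := h.integrable_exp_mul t
  rw [← ofReal_integral_eq_lintegral_ofReal hi
    (Eventually.of_forall fun x => (Real.exp_pos _).le)]
  exact ENNReal.ofReal_le_ofReal (h.mgf_le t)

/-- Integrating the noise first, with the design fixed, turns each factor into an exponential moment
of a squared Gaussian with coefficient `σ2 * u² / 2`. -/
lemma IsSample.lintegral_exp_noise_le (h : IsSample M σ2 P S ν X ξ)
    (w : EuclideanSpace ℝ (Fin p)) {V u : ℝ} (hV0 : 0 ≤ V) (hV : ∀ q, quadForm (S q) w ≤ V)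
    (hu : σ2 * u ^ 2 * V ≤ 1 / 2) :
    ∫⁻ ω, ENNReal.ofReal (Real.exp (u * ∑ q, inner ℝ w (X q ω) * ξ q ω)) ∂P ≤
      ENNReal.ofReal (Real.exp (Fintype.card ι * (σ2 * u ^ 2 * V))) := by
  -- That `ν` is a probability measure is read off from the law of an actual noise variable, so the
  -- empty sample is separate.
  rcases isEmpty_or_nonempty ι with hι | ⟨⟨q0⟩⟩
  · have := h.prob
    simp
  have := h.prob
  have hν : IsProbabilityMeasure ν := (h.noise_law q0).isProbabilityMeasure_iff.1 h.prob
  have hl := h.design_noise_indep.hasLaw_prod (h.design_indep.hasLaw_pi h.design_law)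
    (h.noise_indep.hasLaw_pi h.noise_law)
  have hm : Measurable fun x : EuclideanSpace ℝ (Fin p) => (inner ℝ w x : ℝ) := by fun_prop
  set F : (ι → EuclideanSpace ℝ (Fin p)) × (ι → ℝ) → ℝ≥0∞ := fun z =>
    ∏ q, ENNReal.ofReal (Real.exp (u * inner ℝ w (z.1 q) * z.2 q)) with hF
  have hFm : Measurable F := by
    refine Finset.measurable_prod _ fun q _ => ?_
    have h1 : Measurable fun z : (ι → EuclideanSpace ℝ (Fin p)) × (ι → ℝ) =>
      (inner ℝ w (z.1 q) : ℝ) := hm.comp ((measurable_pi_apply q).comp measurable_fst)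
    have h2 : Measurable fun z : (ι → EuclideanSpace ℝ (Fin p)) × (ι → ℝ) => z.2 q :=
      (measurable_pi_apply q).comp measurable_snd
    fun_prop
  set G : EuclideanSpace ℝ (Fin p) → ℝ≥0∞ := fun x =>
    ENNReal.ofReal (Real.exp ((σ2 * u ^ 2 / 2) * inner ℝ w x ^ 2)) with hG
  have hGm : Measurable G := by fun_prop
  calc _ = ∫⁻ z, F z ∂((Measure.pi fun q => multivariateGaussian 0 (S q)).prod
          (Measure.pi fun _ => ν)) := by
        rw [← hl.lintegral_comp hFm.aemeasurable]
        simp_rw [hF, ← ofReal_exp_sum, Finset.mul_sum, mul_assoc]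
    _ = ∫⁻ x, ∏ q, ∫⁻ y, ENNReal.ofReal (Real.exp (u * inner ℝ w (x q) * y)) ∂ν
          ∂(Measure.pi fun q => multivariateGaussian 0 (S q)) := by
        rw [lintegral_prod _ hFm.aemeasurable]
        refine lintegral_congr fun x => ?_
        exact lintegral_pi_prod (fun _ => ν)
          (f := fun q y => ENNReal.ofReal (Real.exp (u * inner ℝ w (x q) * y)))
          fun q => by fun_prop
    _ ≤ ∫⁻ x, ∏ q, G (x q) ∂(Measure.pi fun q => multivariateGaussian 0 (S q)) := by
        refine lintegral_mono fun x => Finset.prod_le_prod' fun q _ => ?_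
        refine (lintegral_exp_mul_le_of_hasSubgaussianMGF h.subgaussian _).trans (le_of_eq ?_)
        rw [hG]
        ring_nf
    _ ≤ _ := by
        rw [lintegral_pi_prod _ fun _ => hGm]
        refine prod_ofReal_exp_le fun q => ?_
        have h0 : 0 ≤ σ2 * u ^ 2 * V := by positivity
        have h2 : (σ2 * u ^ 2 / 2) * V ≤ 1 / 4 := by linarith
        refine (lintegral_exp_mul_inner_sq_le (h.posSemidef q) w (hV q)
          (by rwa [abs_of_nonneg (by positivity)])).trans
          (ENNReal.ofReal_le_ofReal (Real.exp_le_exp.2 ?_))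
        -- With `a = σ2 * u² / 2`, the bound `aV ≤ 1/4` gives `4(aV)² ≤ aV`, so the exponent is at
        -- most `2aV`.
        have h3 : (σ2 * u ^ 2 / 2) * quadForm (S q) w ≤ (σ2 * u ^ 2 / 2) * V :=
          mul_le_mul_of_nonneg_left (hV q) (by positivity)
        nlinarith

end TransferLasso

namespace TransferLasso

/-! ### Concentration of the empirical moments -/

section

variable {Ω : Type*} [MeasurableSpace Ω] {P : Measure Ω}

lemma measure_ge_le_of_lintegral_exp_le {Z : Ω → ℝ} (hZ : AEMeasurable Z P) {u a b : ℝ}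
    (H : ∫⁻ ω, ENNReal.ofReal (Real.exp (u * Z ω)) ∂P ≤ ENNReal.ofReal (Real.exp b)) :
    P {ω | a ≤ u * Z ω} ≤ ENNReal.ofReal (Real.exp (b - a)) := by
  have hm : AEMeasurable (fun ω => ENNReal.ofReal (Real.exp (u * Z ω))) P := by fun_prop
  have h1 := (mul_meas_ge_le_lintegral₀ hm (ENNReal.ofReal (Real.exp a))).trans H
  have h2 : {ω | ENNReal.ofReal (Real.exp a) ≤ ENNReal.ofReal (Real.exp (u * Z ω))} =
      {ω | a ≤ u * Z ω} := by
    ext ω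
    simp [ENNReal.ofReal_le_ofReal_iff (Real.exp_pos _).le]
  rw [h2] at h1
  have h3 := mul_le_mul_right h1 (ENNReal.ofReal (Real.exp (-a)))
  rwa [← mul_assoc, ← ENNReal.ofReal_mul (Real.exp_pos _).le, ← Real.exp_add, neg_add_cancel,
    Real.exp_zero, ENNReal.ofReal_one, one_mul, ← ENNReal.ofReal_mul (Real.exp_pos _).le,
    ← Real.exp_add, neg_add_eq_sub] at h3

/-- Chernoff at `u = τ√(L/N)` with `τ = u₀/√A`: the condition `L ≤ A * N` is what keeps `u` within
the radius `u₀`. The threshold is chosen so that the exponent is exactly `-3L`; with `L = log p`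
this yields `p⁻³`, enough for a union over `p² + p` events. -/
lemma measure_abs_gt_le_of_lintegral_exp_le {Z : Ω → ℝ} (hZ : AEMeasurable Z P)
    {N L A u₀ c : ℝ} (hN : 0 < N) (hL : 0 ≤ L) (hA : 0 < A) (hLA : L ≤ A * N) (hu₀ : 0 < u₀)
    (H : ∀ u, |u| ≤ u₀ →
      ∫⁻ ω, ENNReal.ofReal (Real.exp (u * Z ω)) ∂P ≤ ENNReal.ofReal (Real.exp (N * (c * u ^ 2)))) :
    P {ω | (c * (u₀ / √A) + 3 / (u₀ / √A)) * √(N * L) < |Z ω|} ≤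
      ENNReal.ofReal (2 * Real.exp (-(3 * L))) := by
  set τ := u₀ / √A with hτ
  have hτ0 : 0 < τ := by positivity
  set u := τ * √(L / N) with hu
  have hu0 : 0 ≤ u := by positivity
  have huu : |u| ≤ u₀ := by
    rw [abs_of_nonneg hu0, hu, hτ, div_mul_eq_mul_div, div_le_iff₀ (by positivity)]
    gcongr
    rw [div_le_iff₀ hN]; exact hLA
  have hu2 : N * (c * u ^ 2) = c * τ ^ 2 * L := by
    rw [hu, mul_pow, Real.sq_sqrt (by positivity)]; field_simp
  have hs : √(L / N) * √(N * L) = L := by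
    rw [← Real.sqrt_mul (by positivity), show L / N * (N * L) = L ^ 2 by field_simp,
      Real.sqrt_sq hL]
  have hT : u * ((c * τ + 3 / τ) * √(N * L)) = c * τ ^ 2 * L + 3 * L := by
    calc _ = τ * (c * τ + 3 / τ) * (√(L / N) * √(N * L)) := by rw [hu]; ring
      _ = _ := by rw [hs]; field_simp
  have hsub : {ω | (c * τ + 3 / τ) * √(N * L) < |Z ω|} ⊆
      {ω | c * τ ^ 2 * L + 3 * L ≤ u * Z ω} ∪ {ω | c * τ ^ 2 * L + 3 * L ≤ (-u) * Z ω} := by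
    intro ω hω
    rw [← hT]
    rcases lt_abs.1 (show _ < |Z ω| from hω) with h | h
    · exact Or.inl (mul_le_mul_of_nonneg_left h.le hu0)
    · right
      change _ ≤ (-u) * Z ω
      rw [neg_mul_comm]
      exact mul_le_mul_of_nonneg_left h.le hu0
  have key : ∀ u', |u'| = |u| → P {ω | c * τ ^ 2 * L + 3 * L ≤ u' * Z ω} ≤
      ENNReal.ofReal (Real.exp (-(3 * L))) := by
    intro u' hu'
    have h1 := H u' (hu' ▸ huu)
    rw [sq_eq_sq_iff_abs_eq_abs _ _ |>.2 hu', hu2] at h1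
    refine (measure_ge_le_of_lintegral_exp_le hZ h1).trans (le_of_eq ?_)
    ring_nf
  calc _ ≤ _ := measure_mono hsub
    _ ≤ _ := measure_union_le _ _
    _ ≤ _ := add_le_add (key u rfl) (key (-u) (abs_neg u))
    _ = _ := by rw [← ENNReal.ofReal_add (Real.exp_pos _).le (Real.exp_pos _).le, two_mul]

end

variable {p : ℕ} {ι : Type} [Fintype ι] {Ω : Type*} [MeasurableSpace Ω]
  {M : ℝ} {σ2 : ℝ≥0} {P : Measure Ω} {S : ι → Matrix (Fin p) (Fin p) ℝ}
  {ν : Measure ℝ} {X : ι → Ω → EuclideanSpace ℝ (Fin p)} {ξ : ι → Ω → ℝ}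

/-- Radius of the exponential moment bounds for the empirical moments. -/
noncomputable def expRadius (M : ℝ) (σ2 : ℝ≥0) : ℝ := 1 / (4 * (4 * M + 1) * (σ2 + 1))

/-- Variance factor of the exponential moment bounds for the empirical moments. -/
noncomputable def expFactor (M : ℝ) (σ2 : ℝ≥0) : ℝ := 4 * (4 * M + 1) ^ 2 * (σ2 + 1)

/-- Constant in the deviation bounds for the empirical moments when `log p ≤ A * N`. -/
noncomputable def deviationConst (M : ℝ) (σ2 : ℝ≥0) (A : ℝ) : ℝ :=
  expFactor M σ2 * (expRadius M σ2 / √A) + 3 / (expRadius M σ2 / √A)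

lemma expRadius_pos (hM : 1 ≤ M) : 0 < expRadius M σ2 := by
  unfold expRadius; positivity

lemma deviationConst_pos (hM : 1 ≤ M) {A : ℝ} (hA : 0 < A) : 0 < deviationConst M σ2 A := by
  have := expRadius_pos (σ2 := σ2) hM
  unfold deviationConst expFactor; positivity

/-- The empirical second moments and the empirical correlations with the noise deviate by at most
`η` (on the scale of sums). -/
def HasSmallDeviations (S : ι → Matrix (Fin p) (Fin p) ℝ) (η : ℝ)
    (x : ι → EuclideanSpace ℝ (Fin p)) (e : ι → ℝ) : Prop :=
  (∀ j l, |∑ q, (x q j * x q l - S q j l)| ≤ η) ∧ ∀ j, |∑ q, x q j * e q| ≤ η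

/-- The sum of two coordinate vectors. -/
noncomputable def coordPair (j l : Fin p) : EuclideanSpace ℝ (Fin p) :=
  EuclideanSpace.single j 1 + EuclideanSpace.single l 1

lemma inner_coordPair (j l : Fin p) (x : EuclideanSpace ℝ (Fin p)) :
    inner ℝ (coordPair j l) x = x j + x l := by
  simp [coordPair, inner_add_left, EuclideanSpace.inner_single_left]

lemma quadForm_coordPair {T : Matrix (Fin p) (Fin p) ℝ} (hT : T.PosSemidef) (j l : Fin p) :
    quadForm T (coordPair j l) = T j j + 2 * T j l + T l l := by
  have hs : T l j = T j l := by simpa using hT.isHermitian.apply j l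
  simp only [quadForm, coordPair, WithLp.ofLp_add, PiLp.ofLp_single, Matrix.mulVec_add,
    add_dotProduct, dotProduct_add, single_dotProduct, Matrix.mulVec_single_one, Matrix.col_apply,
    hs]
  ring

lemma quadForm_single (T : Matrix (Fin p) (Fin p) ℝ) (j : Fin p) :
    quadForm T (EuclideanSpace.single j 1) = T j j := by
  simp [quadForm]

/-- Positivity at `e_j - e_l` gives `2 T j l ≤ T j j + T l l`, so diagonal bounds suffice. -/
lemma quadForm_coordPair_le {T : Matrix (Fin p) (Fin p) ℝ} (hT : T.PosSemidef)
    (hd : ∀ j, T j j ≤ M) (j l : Fin p) : quadForm T (coordPair j l) ≤ 4 * M := by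
  have hs : T l j = T j l := by simpa using hT.isHermitian.apply j l
  have h := quadForm_nonneg hT (EuclideanSpace.single j 1 - EuclideanSpace.single l 1)
  have h2 : quadForm T (EuclideanSpace.single j 1 - EuclideanSpace.single l 1) =
      T j j - 2 * T j l + T l l := by
    simp only [quadForm, WithLp.ofLp_sub, PiLp.ofLp_single, Matrix.mulVec_sub,
      sub_dotProduct, dotProduct_sub, single_dotProduct, Matrix.mulVec_single_one,
      Matrix.col_apply, hs]
    ring
  rw [quadForm_coordPair hT]
  linarith [hd j, hd l]

/-- Polarization: the pair `(j, l)` gives `D_jj + 2 D_jl + D_ll`, while the pair `(j, j)` gives `4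
D_jj`, where `D` is the matrix of deviations. Hence `|D_jl| ≤ 3η/4`. -/
lemma hasSmallDeviations_of_sqDeviation (hS : ∀ q, (S q).PosSemidef) {η : ℝ}
    {x : ι → EuclideanSpace ℝ (Fin p)} {e : ι → ℝ}
    (h1 : ∀ j l, |sqDeviation S (coordPair j l) x| ≤ η) (h2 : ∀ j, |∑ q, x q j * e q| ≤ η) :
    HasSmallDeviations S η x e := by
  refine ⟨fun j l => ?_, h2⟩
  have hd : ∀ j l, sqDeviation S (coordPair j l) x = ∑ q, (x q j * x q j - S q j j) +
      2 * ∑ q, (x q j * x q l - S q j l) + ∑ q, (x q l * x q l - S q l l) := by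
    intro j l
    rw [sqDeviation, Finset.mul_sum, ← Finset.sum_add_distrib, ← Finset.sum_add_distrib]
    refine Finset.sum_congr rfl fun q _ => ?_
    rw [inner_coordPair, quadForm_coordPair (hS q)]
    ring
  have a1 := h1 j l
  have a2 := h1 j j
  have a3 := h1 l l
  rw [hd, abs_le] at a1 a2 a3
  rw [abs_le]
  constructor <;> linarith

theorem IsSample.measure_not_hasSmallDeviations_le (h : IsSample M σ2 P S ν X ξ) (hM : 1 ≤ M)
    {A : ℝ} (hA : 0 < A) (hι : 0 < Fintype.card ι) (hp : 0 < p)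
    (hLA : Real.log p ≤ A * Fintype.card ι) :
    P {ω | ¬ HasSmallDeviations S
        (deviationConst M σ2 A * √(Fintype.card ι * Real.log p))
        (fun q => X q ω) (fun q => ξ q ω)} ≤ ENNReal.ofReal (4 / p) := by
  set η := deviationConst M σ2 A * √(Fintype.card ι * Real.log p) with hη
  have hN : (0 : ℝ) < Fintype.card ι := by exact_mod_cast hι
  have hp1 : (1 : ℝ) ≤ p := by exact_mod_cast hp
  have hL : 0 ≤ Real.log p := Real.log_nonneg hp1
  have hu₀ := expRadius_pos (σ2 := σ2) hM
  have hσ : (0 : ℝ) ≤ σ2 := σ2.2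
  have hX : ∀ q, AEMeasurable (X q) P := fun q => (h.design_law q).aemeasurable
  have hξ : ∀ q, AEMeasurable (ξ q) P := fun q => (h.noise_law q).aemeasurable
  have hV1 : (0 : ℝ) < 4 * M + 1 := by linarith
  -- The radius is small enough for both moment bounds at once: `|u| * 4M ≤ 1/4` for squares and `σ2
  -- * u² * 4M ≤ 1/2` for noise.
  have hrad : expRadius M σ2 * (4 * M + 1) * (σ2 + 1) = 1 / 4 := by
    unfold expRadius; field_simp
  have hrad4 : expRadius M σ2 * (4 * M + 1) ≤ 1 / 4 := by
    rw [← hrad]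
    exact le_mul_of_one_le_right (by positivity) (by linarith)
  have hrad1 : expRadius M σ2 ≤ 1 := by
    have : expRadius M σ2 ≤ expRadius M σ2 * (4 * M + 1) :=
      le_mul_of_one_le_right hu₀.le (by linarith)
    linarith
  have b1 : ∀ j l, P {ω | η < |sqDeviation S (coordPair j l) fun q => X q ω|} ≤
      ENNReal.ofReal (2 * Real.exp (-(3 * Real.log p))) := by
    intro j l
    refine measure_abs_gt_le_of_lintegral_exp_le ?_ hN hL hA hLA hu₀ fun u hu => ?_
    · unfold sqDeviation; fun_prop
    · have hu4 : |u| * (4 * M) ≤ 1 / 4 := by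
        refine le_trans ?_ hrad4
        gcongr
        linarith
      refine (h.lintegral_exp_sqDeviation_le (coordPair j l)
        (fun q => quadForm_coordPair_le (h.posSemidef q) (h.diag_le q) j l) hu4).trans
        (ENNReal.ofReal_le_ofReal (Real.exp_le_exp.2 ?_))
      unfold expFactor
      refine mul_le_mul_of_nonneg_left ?_ hN.le
      calc 4 * (u * (4 * M)) ^ 2 = 4 * (4 * M) ^ 2 * 1 * u ^ 2 := by ring
        _ ≤ 4 * (4 * M + 1) ^ 2 * (σ2 + 1) * u ^ 2 := by
          gcongr <;> linarith
  have b2 : ∀ j, P {ω | η < |∑ q, X q ω j * ξ q ω|} ≤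
      ENNReal.ofReal (2 * Real.exp (-(3 * Real.log p))) := by
    intro j
    have hcoord : ∀ q ω, X q ω j = inner ℝ (EuclideanSpace.single j (1 : ℝ)) (X q ω) := by
      intro q ω
      simp [EuclideanSpace.inner_single_left]
    simp_rw [hcoord]
    refine measure_abs_gt_le_of_lintegral_exp_le ?_ hN hL hA hLA hu₀ fun u hu => ?_
    · fun_prop
    · have hu2 : u ^ 2 ≤ expRadius M σ2 := by
        rw [← sq_abs]
        nlinarith [abs_nonneg u]
      have hu4 : σ2 * u ^ 2 * (4 * M) ≤ 1 / 2 := by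
        calc σ2 * u ^ 2 * (4 * M) ≤ (σ2 + 1) * expRadius M σ2 * (4 * M + 1) := by
              gcongr <;> linarith
          _ = 1 / 4 := by rw [← hrad]; ring
          _ ≤ 1 / 2 := by norm_num
      refine (h.lintegral_exp_noise_le (EuclideanSpace.single j (1 : ℝ)) (V := 4 * M)
        (by linarith) (fun q => ?_) hu4).trans (ENNReal.ofReal_le_ofReal (Real.exp_le_exp.2 ?_))
      · rw [quadForm_single]
        linarith [h.diag_le q j]
      · unfold expFactor
        refine mul_le_mul_of_nonneg_left ?_ hN.le
        have h4 : 4 * M ≤ 4 * (4 * M + 1) ^ 2 := by nlinarith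
        calc σ2 * u ^ 2 * (4 * M) = 4 * M * σ2 * u ^ 2 := by ring
          _ ≤ 4 * (4 * M + 1) ^ 2 * (σ2 + 1) * u ^ 2 := by
            gcongr; linarith
  have hsub : {ω | ¬ HasSmallDeviations S η (fun q => X q ω) (fun q => ξ q ω)} ⊆
      (⋃ jl : Fin p × Fin p, {ω | η < |sqDeviation S (coordPair jl.1 jl.2) fun q => X q ω|}) ∪
        ⋃ j, {ω | η < |∑ q, X q ω j * ξ q ω|} := by
    intro ω hω
    by_contra hc
    simp only [Set.mem_union, Set.mem_iUnion, Set.mem_ofPred_eq, not_or, not_exists, not_lt,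
      Prod.forall] at hc
    exact hω (hasSmallDeviations_of_sqDeviation h.posSemidef hc.1 hc.2)
  have hexp : Real.exp (-(3 * Real.log p)) = ((p : ℝ) ^ 3)⁻¹ := by
    rw [Real.exp_neg, show (3 : ℝ) * Real.log p = Real.log ((p : ℝ) ^ 3) by
      rw [Real.log_pow]; norm_num, Real.exp_log (by positivity)]
  calc _ ≤ _ := measure_mono hsub
    _ ≤ _ := measure_union_le _ _
    _ ≤ ∑ _jl : Fin p × Fin p, ENNReal.ofReal (2 * Real.exp (-(3 * Real.log p))) +
        ∑ _j : Fin p, ENNReal.ofReal (2 * Real.exp (-(3 * Real.log p))) :=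
      add_le_add ((measure_iUnion_fintype_le _ _).trans (Finset.sum_le_sum fun jl _ => b1 _ _))
        ((measure_iUnion_fintype_le _ _).trans (Finset.sum_le_sum fun j _ => b2 _))
    _ = ENNReal.ofReal ((p * p + p) * (2 * Real.exp (-(3 * Real.log p)))) := by
      simp only [Finset.sum_const, Finset.card_univ, Fintype.card_prod, Fintype.card_fin,
        nsmul_eq_mul]
      have hc : ((p : ℝ) * p + p) = ((p * p + p : ℕ) : ℝ) := by push_cast; rfl
      rw [← add_mul, hc, ENNReal.ofReal_mul (Nat.cast_nonneg _), ENNReal.ofReal_natCast]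
      push_cast
      rfl
    _ ≤ _ := by
      refine ENNReal.ofReal_le_ofReal ?_
      rw [hexp, le_div_iff₀ (by positivity)]
      field_simp
      linarith

end TransferLasso

namespace TransferLasso

/-! ### The `ℓ¹` norm -/

section l1

variable {p : ℕ}

lemma l1Norm_nonneg (v : EuclideanSpace ℝ (Fin p)) : 0 ≤ l1Norm v :=
  Finset.sum_nonneg fun _ _ => abs_nonneg _

lemma l1Norm_neg (v : EuclideanSpace ℝ (Fin p)) : l1Norm (-v) = l1Norm v := by
  simp [l1Norm]

lemma l1Norm_sub_comm (v w : EuclideanSpace ℝ (Fin p)) : l1Norm (v - w) = l1Norm (w - v) := by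
  rw [← l1Norm_neg, neg_sub]

lemma l1Norm_add_le (v w : EuclideanSpace ℝ (Fin p)) :
    l1Norm (v + w) ≤ l1Norm v + l1Norm w := by
  rw [l1Norm, l1Norm, l1Norm, ← Finset.sum_add_distrib]
  exact Finset.sum_le_sum fun j _ => abs_add_le _ _

lemma norm_sq_le_l1Norm_sq (v : EuclideanSpace ℝ (Fin p)) : ‖v‖ ^ 2 ≤ l1Norm v ^ 2 := by
  rw [EuclideanSpace.real_norm_sq_eq, l1Norm]
  simp_rw [← sq_abs (v _)]
  exact Finset.sum_sq_le_sq_sum_of_nonneg fun _ _ => abs_nonneg _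

lemma inner_eq_sum (v x : EuclideanSpace ℝ (Fin p)) : inner ℝ v x = ∑ j, v j * x j := by
  simp [PiLp.inner_apply, mul_comm]

lemma abs_sum_mul_le_l1Norm (v : EuclideanSpace ℝ (Fin p)) {g : Fin p → ℝ} {c : ℝ}
    (hg : ∀ j, |g j| ≤ c) : |∑ j, v j * g j| ≤ c * l1Norm v := by
  rw [l1Norm, Finset.mul_sum]
  refine (Finset.abs_sum_le_sum_abs _ _).trans (Finset.sum_le_sum fun j _ => ?_)
  rw [abs_mul, mul_comm]
  exact mul_le_mul_of_nonneg_right (hg j) (abs_nonneg _)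

end l1

/-! ### Deterministic consequences of small deviations -/

variable {p : ℕ} {ι : Type} [Fintype ι] {M κ η : ℝ} {S : ι → Matrix (Fin p) (Fin p) ℝ}
  {x : ι → EuclideanSpace ℝ (Fin p)} {e : ι → ℝ}

lemma sum_inner_mul_eq (x : ι → EuclideanSpace ℝ (Fin p)) (z : ι → ℝ)
    (v : EuclideanSpace ℝ (Fin p)) :
    ∑ q, inner ℝ v (x q) * z q = ∑ j, v j * ∑ q, x q j * z q := by
  simp_rw [inner_eq_sum, Finset.sum_mul, Finset.mul_sum]
  rw [Finset.sum_comm]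
  simp_rw [mul_assoc]

lemma HasSmallDeviations.abs_sum_inner_mul_noise_le (h : HasSmallDeviations S η x e)
    (v : EuclideanSpace ℝ (Fin p)) : |∑ q, inner ℝ v (x q) * e q| ≤ η * l1Norm v := by
  rw [sum_inner_mul_eq]
  exact abs_sum_mul_le_l1Norm v h.2

/-- Applying `ℓ¹`-`ℓ∞` duality twice to the deviation matrix costs `η‖v‖₁²`; the population form
contributes the curvature `κ`. -/
lemma HasSmallDeviations.sum_inner_sq_ge (h : HasSmallDeviations S η x e)
    (hS : ∀ q (v : Fin p → ℝ), κ * (v ⬝ᵥ v) ≤ v ⬝ᵥ (S q).mulVec v)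
    (v : EuclideanSpace ℝ (Fin p)) :
    Fintype.card ι * (κ * ‖v‖ ^ 2) - η * l1Norm v ^ 2 ≤ ∑ q, inner ℝ v (x q) ^ 2 := by
  have h1 : ∑ q, inner ℝ v (x q) ^ 2 - ∑ q, v.ofLp ⬝ᵥ (S q).mulVec v.ofLp =
      ∑ j, v j * ∑ l, v l * ∑ q, (x q j * x q l - S q j l) := by
    rw [← Finset.sum_sub_distrib]
    simp_rw [Finset.mul_sum]
    rw [Finset.sum_congr rfl fun j _ => Finset.sum_comm, Finset.sum_comm]
    refine Finset.sum_congr rfl fun q _ => ?_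
    rw [inner_eq_sum, sq, Finset.sum_mul_sum, dotProduct, ← Finset.sum_sub_distrib]
    refine Finset.sum_congr rfl fun j _ => ?_
    rw [Matrix.mulVec, dotProduct, Finset.mul_sum, ← Finset.sum_sub_distrib]
    refine Finset.sum_congr rfl fun l _ => ?_
    ring
  have h2 : |∑ j, v j * ∑ l, v l * ∑ q, (x q j * x q l - S q j l)| ≤
      (η * l1Norm v) * l1Norm v :=
    abs_sum_mul_le_l1Norm v fun j => abs_sum_mul_le_l1Norm v (h.1 j)
  have h3 : Fintype.card ι * (κ * ‖v‖ ^ 2) ≤ ∑ q, v.ofLp ⬝ᵥ (S q).mulVec v.ofLp := by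
    have h4 : ‖v‖ ^ 2 = v.ofLp ⬝ᵥ v.ofLp := by
      rw [EuclideanSpace.real_norm_sq_eq, dotProduct]
      simp_rw [sq]
    rw [h4, ← nsmul_eq_mul, ← Finset.card_univ, ← Finset.sum_const]
    exact Finset.sum_le_sum fun q _ => hS q _
  nlinarith [(abs_le.1 h2).1]

/-- `|ab| ≤ (a² + b²)/2` reduces to diagonal entries. Absolute values inside the sum allow a single
source to be dominated by the whole sample. -/
lemma HasSmallDeviations.sum_abs_mul_le (h : HasSmallDeviations S η x e)
    (hd : ∀ q j, S q j j ≤ M) (j l : Fin p) :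
    ∑ q, |x q j * x q l| ≤ Fintype.card ι * M + η := by
  have h1 : ∀ j, ∑ q, x q j * x q j ≤ Fintype.card ι * M + η := by
    intro j
    have h2 := (abs_le.1 (h.1 j j)).2
    rw [Finset.sum_sub_distrib] at h2
    have h3 : ∑ q, S q j j ≤ Fintype.card ι * M := by
      rw [← nsmul_eq_mul, ← Finset.card_univ, ← Finset.sum_const]
      exact Finset.sum_le_sum fun q _ => hd q j
    linarith
  have h4 : ∑ q, |x q j * x q l| ≤ ∑ q, (x q j * x q j + x q l * x q l) / 2 := by
    refine Finset.sum_le_sum fun q _ => ?_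
    rw [abs_le]
    constructor <;> nlinarith [sq_nonneg (x q j - x q l), sq_nonneg (x q j + x q l)]
  rw [← Finset.sum_div, Finset.sum_add_distrib] at h4
  linarith [h1 j, h1 l]

/-- The bias caused by the contrasts `d k` of finitely many sources is controlled in `ℓ¹`. -/
lemma HasSmallDeviations.abs_sum_inner_mul_contrast_le {m : ℕ} {H : ℝ}
    (h : HasSmallDeviations S η x e) (hd : ∀ q j, S q j j ≤ M) (src : ι → Fin m)
    {d : Fin m → EuclideanSpace ℝ (Fin p)} (hH : ∀ k, l1Norm (d k) ≤ H)
    (hB : 0 ≤ Fintype.card ι * M + η) (v : EuclideanSpace ℝ (Fin p)) :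
    |∑ q, inner ℝ v (x q) * inner ℝ (d (src q)) (x q)| ≤
      (m * H * (Fintype.card ι * M + η)) * l1Norm v := by
  rw [sum_inner_mul_eq]
  refine abs_sum_mul_le_l1Norm v fun j => ?_
  set B := Fintype.card ι * M + η
  calc |∑ q, x q j * inner ℝ (d (src q)) (x q)|
      ≤ ∑ q, ∑ l, |d (src q) l| * |x q j * x q l| := by
        refine (Finset.abs_sum_le_sum_abs _ _).trans (Finset.sum_le_sum fun q _ => ?_)
        rw [inner_eq_sum, Finset.mul_sum]
        refine (Finset.abs_sum_le_sum_abs _ _).trans (Finset.sum_le_sum fun l _ => ?_)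
        rw [← abs_mul]
        exact le_of_eq (congrArg _ (by ring))
    -- Each observation is charged with all `m` contrasts. This costs a factor `m` but leaves sums
    -- over the full sample, so no concentration per source is needed.
    _ ≤ ∑ q, ∑ k, ∑ l, |d k l| * |x q j * x q l| := by
        refine Finset.sum_le_sum fun q _ => ?_
        exact Finset.single_le_sum (f := fun k => ∑ l, |d k l| * |x q j * x q l|)
          (fun k _ => Finset.sum_nonneg fun l _ => by positivity) (Finset.mem_univ _)
    _ = ∑ k, ∑ l, |d k l| * ∑ q, |x q j * x q l| := by
        rw [Finset.sum_comm]
        refine Finset.sum_congr rfl fun k _ => ?_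
        rw [Finset.sum_comm]
        simp_rw [Finset.mul_sum]
    _ ≤ ∑ k, ∑ l, |d k l| * B :=
        Finset.sum_le_sum fun k _ => Finset.sum_le_sum fun l _ =>
          mul_le_mul_of_nonneg_left (h.sum_abs_mul_le hd j l) (abs_nonneg _)
    _ ≤ ∑ _k : Fin m, H * B := by
        refine Finset.sum_le_sum fun k _ => ?_
        rw [← Finset.sum_mul]
        exact mul_le_mul_of_nonneg_right (hH k) hB
    _ = m * H * B := by simp [mul_assoc]

/-! ### Least squares and lasso -/

/-- Least squares loss of a sample. -/
noncomputable def sampleLoss (x : ι → EuclideanSpace ℝ (Fin p)) (y : ι → ℝ)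
    (b : EuclideanSpace ℝ (Fin p)) : ℝ :=
  (1 / (Fintype.card ι : ℝ)) * ∑ q, (1 / 2 : ℝ) * (y q - inner ℝ b (x q)) ^ 2

/-- The loss is quadratic, so its expansion at `c` is exact. This is the basic identity behind all
three error bounds. -/
lemma card_mul_sampleLoss_sub (hι : 0 < Fintype.card ι) (y : ι → ℝ)
    (b c : EuclideanSpace ℝ (Fin p)) :
    Fintype.card ι * (sampleLoss x y b - sampleLoss x y c) =
      (1 / 2) * ∑ q, inner ℝ (b - c) (x q) ^ 2 -
        ∑ q, inner ℝ (b - c) (x q) * (y q - inner ℝ c (x q)) := by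
  have hN : (Fintype.card ι : ℝ) ≠ 0 := by exact_mod_cast hι.ne'
  rw [sampleLoss, sampleLoss, ← mul_sub, ← mul_assoc, mul_one_div_cancel hN, one_mul,
    ← Finset.sum_sub_distrib, Finset.mul_sum, ← Finset.sum_sub_distrib]
  refine Finset.sum_congr rfl fun q _ => ?_
  rw [inner_sub_left]
  ring

/-- `ℓ¹` error of the lasso under a restricted eigenvalue condition implied by entrywise
deviation bounds. -/
theorem l1Norm_lasso_sub_le {s : ℕ} {lam : ℝ} {y : ι → ℝ} {θ b : EuclideanSpace ℝ (Fin p)}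
    (hι : 0 < Fintype.card ι) (hκ : 0 < κ) (hη : 0 ≤ η) (hlam : 0 < lam) (hs : IsSparse s θ)
    (hquad : ∀ v : EuclideanSpace ℝ (Fin p),
      Fintype.card ι * (κ * ‖v‖ ^ 2) - η * l1Norm v ^ 2 ≤ ∑ q, inner ℝ v (x q) ^ 2)
    (hgrad : ∀ v : EuclideanSpace ℝ (Fin p),
      |∑ q, inner ℝ v (x q) * (y q - inner ℝ θ (x q))| ≤
        Fintype.card ι * (lam / 2) * l1Norm v)
    (hsη : 16 * s * η ≤ Fintype.card ι * (κ / 2))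
    (hb : sampleLoss x y b + lam * l1Norm b ≤ sampleLoss x y θ + lam * l1Norm θ) :
    l1Norm (b - θ) ≤ 32 * s * lam / κ := by
  classical
  have hN : (0 : ℝ) < Fintype.card ι := by exact_mod_cast hι
  set N : ℝ := (Fintype.card ι : ℝ)
  set v := b - θ with hv
  have hbv : ∀ j, b j = θ j + v j := fun j => by simp [hv]
  set T : Finset (Fin p) := Finset.univ.filter fun j => θ j ≠ 0 with hT
  have hTs : (T.card : ℝ) ≤ s := by
    have : ({j : Fin p | θ j ≠ 0} : Set (Fin p)) = (T : Set (Fin p)) := by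
      ext j; simp [hT]
    have h2 := hs
    rw [IsSparse, this, Set.ncard_coe_finset] at h2
    exact_mod_cast h2
  set a := ∑ j ∈ T, |v j| with ha
  have ha0 : 0 ≤ a := Finset.sum_nonneg fun _ _ => abs_nonneg _
  have hl0 := l1Norm_nonneg v
  -- Off the support of `θ` the penalty grows by exactly `|v j|`; on it the triangle inequality
  -- limits the decrease to `|v j|`.
  have hcone : l1Norm θ - l1Norm b ≤ 2 * a - l1Norm v := by
    have h1 : a = ∑ j, if θ j ≠ 0 then |v j| else 0 := by
      rw [ha, hT, Finset.sum_filter]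
    rw [h1, l1Norm, l1Norm, l1Norm, Finset.mul_sum, ← Finset.sum_sub_distrib,
      ← Finset.sum_sub_distrib]
    refine Finset.sum_le_sum fun j _ => ?_
    rw [hbv j]
    by_cases h0 : θ j = 0
    · simp [h0]
    · rw [if_pos h0]
      have h3 : |θ j| ≤ |θ j + v j| + |v j| := by
        have := abs_sub (θ j + v j) (v j)
        rwa [add_sub_cancel_right] at this
      linarith
  have ha2 : a ^ 2 ≤ s * ‖v‖ ^ 2 := by
    have h1 : a ^ 2 ≤ T.card * ∑ j ∈ T, |v j| ^ 2 := sq_sum_le_card_mul_sum_sq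
    have h2 : ∑ j ∈ T, |v j| ^ 2 ≤ ‖v‖ ^ 2 := by
      rw [EuclideanSpace.real_norm_sq_eq]
      simp_rw [sq_abs]
      exact Finset.sum_le_univ_sum_of_nonneg fun _ => sq_nonneg _
    exact h1.trans (mul_le_mul hTs h2 (Finset.sum_nonneg fun _ _ => sq_nonneg _) (by positivity))
  have hbasic := card_mul_sampleLoss_sub (x := x) hι y b θ
  rw [← hv] at hbasic
  have hg := (abs_le.1 (hgrad v)).2
  have hQ := hquad v
  have hQ0 : 0 ≤ ∑ q, inner ℝ v (x q) ^ 2 := Finset.sum_nonneg fun _ _ => sq_nonneg _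
  have h1 : N * (sampleLoss x y b - sampleLoss x y θ) ≤ N * (lam * (2 * a - l1Norm v)) := by
    refine mul_le_mul_of_nonneg_left ?_ hN.le
    nlinarith
  have h2 : (1 / 2) * ∑ q, inner ℝ v (x q) ^ 2 ≤ N * lam * (2 * a - l1Norm v / 2) := by
    nlinarith
  -- The cone condition: the quadratic form is nonnegative, so the right side of `h2` cannot be
  -- negative.
  have h3 : l1Norm v ≤ 4 * a := by
    by_contra hc
    have : N * lam * (2 * a - l1Norm v / 2) < 0 :=
      mul_neg_of_pos_of_neg (by positivity) (by linarith)
    linarith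
  -- On the cone `‖v‖₁² ≤ 16 s ‖v‖²`, so the deviation uses up at most half of the curvature.
  have h4 : η * l1Norm v ^ 2 ≤ N * (κ / 2) * ‖v‖ ^ 2 := by
    calc η * l1Norm v ^ 2 ≤ η * (4 * a) ^ 2 := by gcongr
      _ = 16 * η * a ^ 2 := by ring
      _ ≤ 16 * η * (s * ‖v‖ ^ 2) := by gcongr
      _ = 16 * s * η * ‖v‖ ^ 2 := by ring
      _ ≤ _ := by gcongr
  have h5 : κ * ‖v‖ ^ 2 ≤ 8 * lam * a := by
    have h6 : N * lam * (2 * a - l1Norm v / 2) ≤ N * lam * (2 * a) := by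
      gcongr; linarith
    have h7 : N * (κ * ‖v‖ ^ 2) ≤ N * (8 * lam * a) := by nlinarith
    exact le_of_mul_le_mul_left h7 hN
  have h8 : a ≤ 8 * s * lam / κ := by
    rw [le_div_iff₀ hκ]
    rcases ha0.eq_or_lt with h0 | h0
    · rw [← h0, zero_mul]; positivity
    · refine le_of_mul_le_mul_left ?_ h0
      calc a * (a * κ) = κ * a ^ 2 := by ring
        _ ≤ κ * (s * ‖v‖ ^ 2) := by gcongr
        _ = s * (κ * ‖v‖ ^ 2) := by ring
        _ ≤ s * (8 * lam * a) := by gcongr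
        _ = _ := by ring
  calc l1Norm v ≤ 4 * a := h3
    _ ≤ 4 * (8 * s * lam / κ) := by gcongr
    _ = _ := by ring

/-! ### Fine-tuning around the pooled estimate -/

section FineTuning

variable {γ r : ℝ} {y : ι → ℝ} {θ bP b : EuclideanSpace ℝ (Fin p)}

/-- `θ` is feasible, so the loss difference is nonpositive and the error has `ℓ¹` norm at most `2r`.
The constants are loosened to match the Lagrangian case. -/
theorem constrained_error_le (hι : 0 < Fintype.card ι) (hγ : 0 ≤ γ)
    (hquad : ∀ v : EuclideanSpace ℝ (Fin p),
      Fintype.card ι * (κ * ‖v‖ ^ 2) - Fintype.card ι * γ * l1Norm v ^ 2 ≤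
        ∑ q, inner ℝ v (x q) ^ 2)
    (hgrad : ∀ v : EuclideanSpace ℝ (Fin p),
      |∑ q, inner ℝ v (x q) * (y q - inner ℝ θ (x q))| ≤ Fintype.card ι * γ * l1Norm v)
    (hP : l1Norm (bP - θ) ≤ r) (hb : l1Norm (bP - b) ≤ r)
    (hmin : sampleLoss x y b ≤ sampleLoss x y θ) :
    l1Norm (b - θ) ≤ 4 * r ∧ κ * ‖b - θ‖ ^ 2 ≤ 16 * γ * r * (1 + r) := by
  have hN : (0 : ℝ) < Fintype.card ι := by exact_mod_cast hι
  have hr : 0 ≤ r := (l1Norm_nonneg _).trans hP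
  have hl : l1Norm (b - θ) ≤ 2 * r := by
    have := l1Norm_add_le (b - bP) (bP - θ)
    rw [sub_add_sub_cancel, l1Norm_sub_comm b bP] at this
    linarith
  have hl0 := l1Norm_nonneg (b - θ)
  refine ⟨by linarith, le_of_mul_le_mul_left ?_ hN⟩
  have h1 := card_mul_sampleLoss_sub (x := x) hι y b θ
  have h2 := hquad (b - θ)
  have h3 := (abs_le.1 (hgrad (b - θ))).2
  have h4 : Fintype.card ι * (sampleLoss x y b - sampleLoss x y θ) ≤ 0 :=
    mul_nonpos_of_nonneg_of_nonpos hN.le (by linarith)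
  calc Fintype.card ι * (κ * ‖b - θ‖ ^ 2) ≤ Fintype.card ι * γ * l1Norm (b - θ) ^ 2 +
        2 * (Fintype.card ι * γ * l1Norm (b - θ)) := by linarith
    _ ≤ Fintype.card ι * γ * (2 * r) ^ 2 + 2 * (Fintype.card ι * γ * (2 * r)) := by gcongr
    _ = Fintype.card ι * (γ * (4 * r ^ 2 + 4 * r)) := by ring
    _ ≤ Fintype.card ι * (γ * (16 * r ^ 2 + 16 * r)) := by gcongr <;> norm_num
    _ = _ := by ring

/-- The penalty `2γ` is twice the noise level: after the noise term `γ(‖d‖₁ + r)` is paid, `γ(3r -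
‖d‖₁)` bounds a nonnegative quadratic form. Hence `‖d‖₁ ≤ 3r`. -/
theorem lagrangian_error_le {d : EuclideanSpace ℝ (Fin p)} (hι : 0 < Fintype.card ι) (hγ : 0 < γ)
    (hquad : ∀ v : EuclideanSpace ℝ (Fin p),
      Fintype.card ι * (κ * ‖v‖ ^ 2) - Fintype.card ι * γ * l1Norm v ^ 2 ≤
        ∑ q, inner ℝ v (x q) ^ 2)
    (hgrad : ∀ v : EuclideanSpace ℝ (Fin p),
      |∑ q, inner ℝ v (x q) * (y q - inner ℝ θ (x q))| ≤ Fintype.card ι * γ * l1Norm v)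
    (hP : l1Norm (bP - θ) ≤ r) (hb : b = bP + d)
    (hmin : sampleLoss x y b + 2 * γ * l1Norm d ≤
      sampleLoss x y θ + 2 * γ * l1Norm (θ - bP)) :
    l1Norm (b - θ) ≤ 4 * r ∧ κ * ‖b - θ‖ ^ 2 ≤ 16 * γ * r * (1 + r) := by
  have hN : (0 : ℝ) < Fintype.card ι := by exact_mod_cast hι
  have hr : 0 ≤ r := (l1Norm_nonneg _).trans hP
  have hl : l1Norm (b - θ) ≤ l1Norm d + r := by
    have := l1Norm_add_le d (bP - θ)
    rw [show d + (bP - θ) = b - θ by rw [hb]; abel] at this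
    linarith
  rw [l1Norm_sub_comm θ bP] at hmin
  have hd0 := l1Norm_nonneg d
  have hl0 := l1Norm_nonneg (b - θ)
  have h1 := card_mul_sampleLoss_sub (x := x) hι y b θ
  have h2 := hquad (b - θ)
  have h3 := (abs_le.1 (hgrad (b - θ))).2
  have h4 : Fintype.card ι * (sampleLoss x y b - sampleLoss x y θ) ≤
      Fintype.card ι * (2 * γ * (r - l1Norm d)) := by
    refine mul_le_mul_of_nonneg_left ?_ hN.le
    nlinarith
  have h3' : Fintype.card ι * γ * l1Norm (b - θ) ≤ Fintype.card ι * γ * (l1Norm d + r) := by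
    gcongr
  have hQ0 : 0 ≤ ∑ q, inner ℝ (b - θ) (x q) ^ 2 := Finset.sum_nonneg fun _ _ => sq_nonneg _
  have h5 : (1 / 2) * ∑ q, inner ℝ (b - θ) (x q) ^ 2 ≤
      Fintype.card ι * γ * (3 * r - l1Norm d) := by nlinarith
  have hd : l1Norm d ≤ 3 * r := by
    by_contra hc
    have : Fintype.card ι * γ * (3 * r - l1Norm d) < 0 :=
      mul_neg_of_pos_of_neg (by positivity) (by linarith)
    linarith
  have hl4 : l1Norm (b - θ) ≤ 4 * r := by linarith
  refine ⟨hl4, le_of_mul_le_mul_left ?_ hN⟩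
  have h6 : Fintype.card ι * γ * (3 * r - l1Norm d) ≤ Fintype.card ι * γ * (3 * r) := by
    gcongr; linarith
  calc Fintype.card ι * (κ * ‖b - θ‖ ^ 2) ≤ Fintype.card ι * γ * l1Norm (b - θ) ^ 2 +
        2 * (Fintype.card ι * γ * (3 * r)) := by linarith
    _ ≤ Fintype.card ι * γ * (4 * r) ^ 2 + 2 * (Fintype.card ι * γ * (3 * r)) := by gcongr
    _ = Fintype.card ι * (γ * (16 * r ^ 2 + 6 * r)) := by ring
    _ ≤ Fintype.card ι * (γ * (16 * r ^ 2 + 16 * r)) := by gcongr; norm_num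
    _ = _ := by ring

end FineTuning

end TransferLasso

namespace TransferLasso

/-! ### The transfer model -/

section Model

variable {K p s : ℕ} {n : Fin (K + 1) → ℕ} {Ω : Type*} [MeasurableSpace Ω]
  {M M' κ h : ℝ} {σ2 : ℝ≥0} {P : Measure Ω} {θ : Fin (K + 1) → EuclideanSpace ℝ (Fin p)}
  {S : Fin (K + 1) → Matrix (Fin p) (Fin p) ℝ} {ν : Measure ℝ}
  {X : ∀ k, Fin (n k) → Ω → EuclideanSpace ℝ (Fin p)} {ξ : ∀ k, Fin (n k) → Ω → ℝ}

lemma IsModel.isSample_pooled (hm : IsModel s M κ σ2 h P θ S ν X ξ) (hM : M ≤ M') :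
    IsSample M' σ2 P (fun q : Σ k, Fin (n k) => S q.1) ν (fun q => X q.1 q.2)
      (fun q => ξ q.1 q.2) where
  prob := hm.prob
  posSemidef q := (hm.posDef q.1).posSemidef
  diag_le q j := (hm.diag_le q.1 j).trans hM
  subgaussian := hm.subgaussian
  design_law q := hm.design_law q.1 q.2
  noise_law q := hm.noise_law q.1 q.2
  design_indep := hm.design_indep
  noise_indep := hm.noise_indep
  design_noise_indep := hm.design_noise_indep

lemma IsModel.isSample_target (hm : IsModel s M κ σ2 h P θ S ν X ξ) (hM : M ≤ M') :
    IsSample M' σ2 P (fun _ : Fin (n 0) => S 0) ν (X 0) (ξ 0) where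
  prob := hm.prob
  posSemidef _ := (hm.posDef 0).posSemidef
  diag_le _ j := (hm.diag_le 0 j).trans hM
  subgaussian := hm.subgaussian
  design_law := hm.design_law 0
  noise_law := hm.noise_law 0
  design_indep := hm.design_indep.precomp (g := fun i : Fin (n 0) => ⟨0, i⟩)
    fun i j hij => by simpa using hij
  noise_indep := hm.noise_indep.precomp (g := fun i : Fin (n 0) => ⟨0, i⟩)
    fun i j hij => by simpa using hij
  design_noise_indep := by
    have hφ : Measurable fun (f : (Σ k, Fin (n k)) → EuclideanSpace ℝ (Fin p))
      (i : Fin (n 0)) => f ⟨0, i⟩ := by fun_prop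
    have hψ : Measurable fun (f : (Σ k, Fin (n k)) → ℝ) (i : Fin (n 0)) => f ⟨0, i⟩ := by
      fun_prop
    exact hm.design_noise_indep.comp hφ hψ

lemma pooledSize_eq_card (n : Fin (K + 1) → ℕ) :
    pooledSize n = Fintype.card (Σ k, Fin (n k)) := by
  simp [pooledSize]

lemma pooledLoss_eq_sampleLoss (x : ∀ k, Fin (n k) → EuclideanSpace ℝ (Fin p))
    (y : ∀ k, Fin (n k) → ℝ) (b : EuclideanSpace ℝ (Fin p)) :
    pooledLoss x y b =
      sampleLoss (fun q : Σ k, Fin (n k) => x q.1 q.2) (fun q => y q.1 q.2) b := by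
  rw [pooledLoss, sampleLoss, pooledSize_eq_card, Fintype.sum_sigma]

lemma targetLoss_eq_sampleLoss (x : ∀ k, Fin (n k) → EuclideanSpace ℝ (Fin p))
    (y : ∀ k, Fin (n k) → ℝ) (b : EuclideanSpace ℝ (Fin p)) :
    targetLoss x y b = sampleLoss (x 0) (y 0) b := by
  rw [targetLoss, sampleLoss, Fintype.card_fin]

variable {x : ∀ k, Fin (n k) → EuclideanSpace ℝ (Fin p)} {e : ∀ k, Fin (n k) → ℝ}
  {bP b : EuclideanSpace ℝ (Fin p)} {γ r lam : ℝ}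

/-- Residuals at `θ 0` split into noise and the bias of `θ k - θ 0`; `lam / 2` dominates both
gradients. -/
theorem IsModel.l1Norm_pooled_sub_le (hm : IsModel s M κ σ2 h P θ S ν X ξ) (hκ : 0 < κ)
    (hM : M ≤ M') (hM' : 1 ≤ M') (hn : 0 < pooledSize n) (hlam : 0 < lam) (hγ : 0 ≤ γ)
    (hγ1 : γ ≤ 1) (hsγ : 16 * s * γ ≤ κ / 2)
    (hlamγ : γ + (K + 1) * h * (M' + 1) ≤ lam / 2)
    (hdev : HasSmallDeviations (fun q : Σ k, Fin (n k) => S q.1) (pooledSize n * γ)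
      (fun q => x q.1 q.2) (fun q => e q.1 q.2))
    (hb : IsPooledEstimate x (response θ x e) lam bP) :
    l1Norm (bP - θ 0) ≤ 32 * s * lam / κ := by
  have hN : (0 : ℝ) < pooledSize n := by exact_mod_cast hn
  have hh : 0 ≤ h := (l1Norm_nonneg _).trans (hm.contrast 0)
  have hmin := hb (θ 0)
  rw [pooledLoss_eq_sampleLoss, pooledLoss_eq_sampleLoss] at hmin
  have hcard := pooledSize_eq_card n
  have hι : 0 < Fintype.card (Σ k, Fin (n k)) := hcard ▸ hn
  refine l1Norm_lasso_sub_le hι hκ (mul_nonneg hN.le hγ) hlam hm.sparse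
    (hdev.sum_inner_sq_ge fun q => hm.eigenvalue_ge q.1) (fun v => ?_) ?_ hmin
  · have hbias := hdev.abs_sum_inner_mul_contrast_le
      (fun q j => (hm.diag_le q.1 j).trans hM) (fun q => q.1) (d := fun k => θ k - θ 0)
      (fun k => by rw [l1Norm_sub_comm]; exact hm.contrast k) (by positivity) v
    have hnoise := hdev.abs_sum_inner_mul_noise_le v
    rw [← hcard] at hbias ⊢
    have hsplit : ∑ q : Σ k, Fin (n k), inner ℝ v (x q.1 q.2) *
        (response θ x e q.1 q.2 - inner ℝ (θ 0) (x q.1 q.2)) =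
        ∑ q : Σ k, Fin (n k), inner ℝ v (x q.1 q.2) * inner ℝ (θ q.1 - θ 0) (x q.1 q.2) +
          ∑ q : Σ k, Fin (n k), inner ℝ v (x q.1 q.2) * e q.1 q.2 := by
      rw [← Finset.sum_add_distrib]
      refine Finset.sum_congr rfl fun q _ => ?_
      rw [response, inner_sub_left]
      ring
    rw [hsplit]
    refine (abs_add_le _ _).trans ((add_le_add hbias hnoise).trans ?_)
    rw [← add_mul]
    refine mul_le_mul_of_nonneg_right ?_ (l1Norm_nonneg v)
    push_cast
    calc ((K : ℝ) + 1) * h * (pooledSize n * M' + pooledSize n * γ) + pooledSize n * γ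
        = pooledSize n * (γ + (K + 1) * h * (M' + γ)) := by ring
      _ ≤ pooledSize n * (γ + (K + 1) * h * (M' + 1)) := by gcongr
      _ ≤ _ := by gcongr
  · rw [← hcard]
    nlinarith

/-- The target data also enter `bP`, but this is harmless: the deviation bounds hold for all
directions simultaneously. -/
theorem IsModel.fineTuned_error_le (hm : IsModel s M κ σ2 h P θ S ν X ξ)
    (hn : 0 < n 0) (hγ : 0 < γ)
    (hdev : HasSmallDeviations (fun _ : Fin (n 0) => S 0) (n 0 * γ) (x 0) (e 0))
    (hP : l1Norm (bP - θ 0) ≤ r)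
    (hb : IsConstrainedEstimate x (response θ x e) r bP b ∨
      IsLagrangianEstimate x (response θ x e) (2 * γ) bP b) :
    l1Norm (b - θ 0) ≤ 4 * r ∧ κ * ‖b - θ 0‖ ^ 2 ≤ 16 * γ * r * (1 + r) := by
  have hι : 0 < Fintype.card (Fin (n 0)) := by rwa [Fintype.card_fin]
  have hquad := hdev.sum_inner_sq_ge fun _ => hm.eigenvalue_ge 0
  have hgrad : ∀ v : EuclideanSpace ℝ (Fin p), |∑ i, inner ℝ v (x 0 i) *
      (response θ x e 0 i - inner ℝ (θ 0) (x 0 i))| ≤ n 0 * γ * l1Norm v := by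
    intro v
    simp only [response, add_sub_cancel_left]
    exact hdev.abs_sum_inner_mul_noise_le v
  rcases hb with ⟨hb, hmin⟩ | ⟨d, hd, hmin⟩
  · have h1 := hmin (θ 0) hP
    rw [targetLoss_eq_sampleLoss, targetLoss_eq_sampleLoss] at h1
    exact constrained_error_le hι hγ.le (by simpa using hquad) (by simpa using hgrad) hP hb h1
  · have h1 := hmin (θ 0 - bP)
    rw [targetLoss_eq_sampleLoss, targetLoss_eq_sampleLoss, ← hd, add_sub_cancel] at h1
    exact lagrangian_error_le hι hγ (by simpa using hquad) (by simpa using hgrad) hP hd h1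

end Model

/-! ### Rates -/

lemma sqrt_mul_eq_mul_sqrt_div {N L : ℝ} (hN : 0 < N) : √(N * L) = N * √(L / N) := by
  rw [← Real.sqrt_sq hN.le, ← Real.sqrt_mul (by positivity), Real.sqrt_sq hN.le]
  congr 1
  field_simp

/-- Here `z` is the squared `ℓ²` error. `h1` gives the first term of the minimum, with `1 + r ≤ 1 +
C`; `h2` gives the second through `w² ≤ 2(log p / n_P + h²)`. -/
lemma le_mul_transferRate {p n₀ nP : ℕ} {h B C κ z r : ℝ} (hκ : 0 < κ) (hB : 0 ≤ B)
    (hC : 0 ≤ C) (hh : 0 ≤ h) (hw : poolingRate p nP h ≤ 1) (hr : r = C * poolingRate p nP h)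
    (h1 : κ * z ≤ 16 * (B * √(Real.log p / n₀)) * r * (1 + r)) (h2 : z ≤ (4 * r) ^ 2) :
    z ≤ (16 * B * C * (1 + C) / κ + 32 * C ^ 2) * transferRate p n₀ nP h := by
  have hL : 0 ≤ Real.log p := Real.log_natCast_nonneg p
  set w := poolingRate p nP h with hwdef
  have hw0 : 0 ≤ w := by rw [hwdef, poolingRate]; positivity
  have hwe : √(Real.log p / nP) + h = w := rfl
  rw [transferRate, mul_min_of_nonneg _ _ (by positivity), le_min_iff, hwe]
  constructor
  · have h3 : z ≤ 16 * B * C * (1 + C) / κ * (√(Real.log p / n₀) * w) := by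
      rw [div_mul_eq_mul_div, le_div_iff₀ hκ]
      calc z * κ = κ * z := mul_comm _ _
        _ ≤ 16 * (B * √(Real.log p / n₀)) * r * (1 + r) := h1
        _ ≤ 16 * (B * √(Real.log p / n₀)) * (C * w) * (1 + C) := by
          rw [hr]
          gcongr
          exact mul_le_of_le_one_right hC hw
        _ = _ := by ring
    refine h3.trans ?_
    gcongr
    exact le_add_of_nonneg_right (by positivity)
  · have h3 : w ^ 2 ≤ 2 * (Real.log p / nP + h ^ 2) := by
      have h4 : √(Real.log p / nP) ^ 2 = Real.log p / nP := Real.sq_sqrt (by positivity)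
      rw [← h4, ← hwe]
      exact add_sq_le
    calc z ≤ (4 * r) ^ 2 := h2
      _ = 16 * C ^ 2 * w ^ 2 := by rw [hr]; ring
      _ ≤ 16 * C ^ 2 * (2 * (Real.log p / nP + h ^ 2)) := by gcongr
      _ = 32 * C ^ 2 * (Real.log p / nP + h ^ 2) := by ring
      _ ≤ _ := by
        gcongr
        exact le_add_of_nonneg_left (by positivity)

end TransferLasso

/-! ### Choice of tuning parameters and passage to the limit -/

open TransferLasso

theorem mainTheorem3 (K s : ℕ) (M κ : ℝ) (hκ : 0 < κ) (σ2 : ℝ≥0) :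
    ∃ C₀ : ℝ, 0 < C₀ ∧ ∀ C₁ : ℝ,
      ∀ (n : ℕ → Fin (K + 1) → ℕ) (p : ℕ → ℕ) (h lam : ℕ → ℝ),
      (∀ k, Tendsto (fun t => n t k) atTop atTop) →
      Tendsto p atTop atTop →
      Tendsto (fun t => Real.log (p t) / (TransferLasso.pooledSize (n t) : ℝ)) atTop (𝓝 0) →
      (fun t => Real.log (p t)) =O[atTop] (fun t => (n t 0 : ℝ)) →
      (∀ t, 0 ≤ h t) →
      Tendsto h atTop (𝓝 0) →
      (∀ᶠ t in atTop,
        C₀ * TransferLasso.poolingRate (p t) (TransferLasso.pooledSize (n t)) (h t) ≤ lam t ∧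
        lam t ≤ C₁ * TransferLasso.poolingRate (p t) (TransferLasso.pooledSize (n t)) (h t)) →
      ∃ r ζ : ℕ → ℝ, (∀ t, 0 < r t) ∧ (∀ t, 0 < ζ t) ∧
        ∀ (Ω : ℕ → Type*) [∀ t, MeasurableSpace (Ω t)] (P : ∀ t, Measure (Ω t))
          (θ : ∀ t, Fin (K + 1) → EuclideanSpace ℝ (Fin (p t)))
          (S : ∀ t, Fin (K + 1) → Matrix (Fin (p t)) (Fin (p t)) ℝ)
          (ν : ℕ → Measure ℝ)
          (X : ∀ t k, Fin (n t k) → Ω t → EuclideanSpace ℝ (Fin (p t)))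
          (ξ : ∀ t k, Fin (n t k) → Ω t → ℝ),
          (∀ t, TransferLasso.IsModel s M κ σ2 (h t) (P t) (θ t) (S t) (ν t) (X t) (ξ t)) →
          ∀ (bP b : ∀ t, Ω t → EuclideanSpace ℝ (Fin (p t))),
            (∀ᶠ t in atTop, ∀ᵐ ω ∂(P t), TransferLasso.IsPooledEstimate (fun k i => X t k i ω)
              (TransferLasso.response (θ t) (fun k i => X t k i ω) (fun k i => ξ t k i ω))
              (lam t) (bP t ω)) →
            ((∀ᶠ t in atTop, ∀ᵐ ω ∂(P t), TransferLasso.IsConstrainedEstimate (fun k i => X t k i ω)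
                (TransferLasso.response (θ t) (fun k i => X t k i ω) (fun k i => ξ t k i ω))
                (r t) (bP t ω) (b t ω)) ∨
              (∀ᶠ t in atTop, ∀ᵐ ω ∂(P t), TransferLasso.IsLagrangianEstimate (fun k i => X t k i ω)
                (TransferLasso.response (θ t) (fun k i => X t k i ω) (fun k i => ξ t k i ω))
                (ζ t) (bP t ω) (b t ω))) →
            TransferLasso.IsBigOp P (fun t ω => ‖b t ω - θ t 0‖ ^ 2)
              (fun t => TransferLasso.transferRate (p t) (n t 0)
                (TransferLasso.pooledSize (n t)) (h t)) := by
  set M' := max M 1 with hM'def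
  have hMM' : M ≤ M' := le_max_left _ _
  have hM' : 1 ≤ M' := le_max_right _ _
  -- Since `log p / n_P → 0`, the ratio is eventually at most `1`. Taking `A = 1` here keeps `C₀`
  -- independent of the constant in `log p = O(n₀)`, which enters only `BT`.
  set BP := deviationConst M' σ2 1 with hBP
  have hBP0 : 0 < BP := deviationConst_pos hM' one_pos
  -- Chosen so that `lam / 2` dominates the noise level `γP` plus the contrast bias `(K + 1) * h *
  -- (M' + 1)`.
  refine ⟨2 * (BP + (K + 1) * (M' + 1)), by positivity, ?_⟩
  intro C₁ n p h lam hn hp hLP hL0 hh0 hh hlam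
  obtain ⟨A, hA, hLA⟩ := hL0.exists_pos
  rw [Asymptotics.isBigOWith_iff] at hLA
  set BT := deviationConst M' σ2 A with hBT
  have hBT0 : 0 < BT := deviationConst_pos hM' hA
  -- The lasso `ℓ¹` error constant; the `+ 1` keeps the radius positive when `s = 0`.
  set C : ℝ := 32 * s * |C₁| / κ + 1 with hCdef
  have hC : 0 < C := by positivity
  set w : ℕ → ℝ := fun t => poolingRate (p t) (pooledSize (n t)) (h t) with hw
  set γP : ℕ → ℝ := fun t => BP * √(Real.log (p t) / pooledSize (n t)) with hγP
  set γ : ℕ → ℝ := fun t => BT * √(Real.log (p t) / n t 0) with hγ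
  -- The default `1` only secures positivity at every `t`; eventually `p ≥ 2` and `n₀ > 0`, and the
  -- first branch applies.
  refine ⟨fun t => if 0 < C * w t then C * w t else 1,
    fun t => if 0 < 2 * γ t then 2 * γ t else 1, fun t => ?_, fun t => ?_, ?_⟩
  · dsimp only
    split_ifs with h0
    exacts [h0, one_pos]
  · dsimp only
    split_ifs with h0
    exacts [h0, one_pos]
  intro Ω _ P θ S ν X ξ hmodel bP b hbP hb ε hε
  have hsqrt : Tendsto (fun t => √(Real.log (p t) / pooledSize (n t))) atTop (𝓝 0) := by
    simpa using hLP.sqrt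
  have hγP_lim : Tendsto γP atTop (𝓝 0) := by
    simpa only [mul_zero] using hsqrt.const_mul BP
  have hsγP_lim : Tendsto (fun t => 16 * s * γP t) atTop (𝓝 0) := by
    simpa using hγP_lim.const_mul (16 * (s : ℝ))
  have hw_lim : Tendsto w atTop (𝓝 0) := by simpa [hw, poolingRate] using hsqrt.add hh
  -- Failure probability `4 / p` for each of the pooled and target samples.
  have hp_lim : Tendsto (fun t => 8 / (p t : ℝ)) atTop (𝓝 0) :=
    (tendsto_natCast_atTop_atTop.comp hp).const_div_atTop 8
  have hb' : ∀ᶠ t in atTop, ∀ᵐ ω ∂(P t),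
      IsConstrainedEstimate (fun k i => X t k i ω)
        (response (θ t) (fun k i => X t k i ω) (fun k i => ξ t k i ω))
        (if 0 < C * w t then C * w t else 1) (bP t ω) (b t ω) ∨
      IsLagrangianEstimate (fun k i => X t k i ω)
        (response (θ t) (fun k i => X t k i ω) (fun k i => ξ t k i ω))
        (if 0 < 2 * γ t then 2 * γ t else 1) (bP t ω) (b t ω) := by
    rcases hb with hb | hb
    · exact hb.mono fun t ht => ht.mono fun ω hω => Or.inl hω
    · exact hb.mono fun t ht => ht.mono fun ω hω => Or.inr hω
  refine ⟨16 * BT * C * (1 + C) / κ + 32 * C ^ 2, by positivity, ?_⟩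
  filter_upwards [hlam, hLA, hbP, hb', (hn 0).eventually_gt_atTop 0, hp.eventually_ge_atTop 2,
    hγP_lim.eventually_le_const one_pos, hsγP_lim.eventually_le_const (half_pos hκ),
    hw_lim.eventually_le_const one_pos, hp_lim.eventually_le_const hε,
    hLP.eventually_le_const one_pos]
    with t hlam hLA hbP hb hn0 hp2 hγP1 hsγ hw1 hpε hLP1
  have hm := hmodel t
  have := hm.prob
  have hnP : 0 < pooledSize (n t) :=
    hn0.trans_le (Finset.single_le_sum (f := n t) (fun _ _ => Nat.zero_le _) (Finset.mem_univ 0))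
  have hN0 : (0 : ℝ) < n t 0 := by exact_mod_cast hn0
  have hNP : (0 : ℝ) < pooledSize (n t) := by exact_mod_cast hnP
  have hp0 : 0 < p t := by omega
  have hLpos : 0 < Real.log (p t) := Real.log_pos (by exact_mod_cast hp2)
  have hwpos : 0 < w t := by
    have : 0 < √(Real.log (p t) / pooledSize (n t)) := by positivity
    exact add_pos_of_pos_of_nonneg this (hh0 t)
  have hγpos : 0 < γ t := by positivity
  have hCw : 0 < C * w t := by positivity
  have h2γ : 0 < 2 * γ t := by positivity
  rw [if_pos hCw, if_pos h2γ] at hb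
  have hlam0 : 0 < lam t := lt_of_lt_of_le (by positivity) hlam.1
  have hrate : γP t + (K + 1) * h t * (M' + 1) ≤ lam t / 2 := by
    have h1 : BP * √(Real.log (p t) / pooledSize (n t)) + (K + 1) * h t * (M' + 1) ≤
        (BP + (K + 1) * (M' + 1)) * (√(Real.log (p t) / pooledSize (n t)) + h t) := by
      have h2 := mul_nonneg hBP0.le (hh0 t)
      have h3 : 0 ≤ (K + 1) * (M' + 1) * √(Real.log (p t) / pooledSize (n t)) := by positivity
      nlinarith
    have h2 := hlam.1
    simp only [poolingRate] at h2
    simp only [hγP]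
    linarith
  have hLA' : Real.log (p t) ≤ A * n t 0 := by
    simpa [abs_of_pos hLpos] using hLA
  have hLP' : Real.log (p t) ≤ 1 * pooledSize (n t) := (div_le_iff₀ hNP).1 hLP1
  have hprobP := (hm.isSample_pooled hMM').measure_not_hasSmallDeviations_le hM' one_pos
    (by rwa [← pooledSize_eq_card]) hp0 (by rwa [← pooledSize_eq_card])
  have hprobT := (hm.isSample_target hMM').measure_not_hasSmallDeviations_le hM' hA
    (by rwa [Fintype.card_fin]) hp0 (by rwa [Fintype.card_fin])
  rw [← pooledSize_eq_card, sqrt_mul_eq_mul_sqrt_div hNP, mul_left_comm] at hprobP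
  rw [Fintype.card_fin, sqrt_mul_eq_mul_sqrt_div hN0, mul_left_comm] at hprobT
  -- Only almost-everywhere inclusion in the two failure events is used, so the minimizers need not
  -- be measurable in `ω`.
  refine (measure_mono_ae ?_).trans ((measure_union_le _ _).trans
    ((add_le_add hprobP hprobT).trans ?_))
  · filter_upwards [hbP, hb] with ω hbP hb hbad
    by_contra hgood
    have hgood' := not_or.1 hgood
    have hdevP := not_not.1 hgood'.1
    have hdevT := not_not.1 hgood'.2
    have hpool := hm.l1Norm_pooled_sub_le hκ hMM' hM' hnP hlam0
      (by positivity) hγP1 hsγ hrate hdevP hbP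
    have hpool' : l1Norm (bP t ω - θ t 0) ≤ C * w t := by
      refine hpool.trans ?_
      have h1 : lam t ≤ |C₁| * w t :=
        hlam.2.trans (mul_le_mul_of_nonneg_right (le_abs_self _) hwpos.le)
      calc 32 * s * lam t / κ ≤ 32 * s * (|C₁| * w t) / κ := by gcongr
        _ = 32 * s * |C₁| / κ * w t := by ring
        _ ≤ C * w t := by gcongr; exact (lt_add_one _).le
    obtain ⟨h1, h2⟩ := hm.fineTuned_error_le hn0 hγpos hdevT hpool' hb
    have h3 : ‖b t ω - θ t 0‖ ^ 2 ≤ (4 * (C * w t)) ^ 2 :=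
      (norm_sq_le_l1Norm_sq _).trans (pow_le_pow_left₀ (l1Norm_nonneg _) h1 2)
    have h4 := le_mul_transferRate hκ hBT0.le hC.le (hh0 t) hw1 rfl h2 h3
    have hbad' : (16 * BT * C * (1 + C) / κ + 32 * C ^ 2) *
        |transferRate (p t) (n t 0) (pooledSize (n t)) (h t)| < |‖b t ω - θ t 0‖ ^ 2| := hbad
    rw [abs_of_nonneg (sq_nonneg ‖_‖)] at hbad'
    have h5 := mul_le_mul_of_nonneg_left
      (le_abs_self (transferRate (p t) (n t 0) (pooledSize (n t)) (h t)))
      (show 0 ≤ 16 * BT * C * (1 + C) / κ + 32 * C ^ 2 by positivity)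
    linarith
  · rw [← ENNReal.ofReal_add (by positivity) (by positivity)]
    refine ENNReal.ofReal_le_ofReal (le_trans (le_of_eq ?_) hpε)
    ring
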